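/- Let $(Q,\langle\!\langle\cdot,\cdot\rangle\!\rangle)$ be a smooth Riemannian manifold (finite-dimensional, Hausdorff, without boundary), let $G$ be a Lie group with Lie algebra $\mathfrak g$ acting smoothly and properly on $Q$ by isometries, and let $X_\lambda$, $\lambda\in\mathbb R$, be a family of smooth $G$-equivariant vector fields on $Q$. A point $q\in Q$ is a relative equilibrium of $X_\lambda$ if $X_\lambda(q)=\frac{d}{dt}\big|_{t=0}\exp(t\xi)\cdot q$ for some $\xi\in\mathfrak g$. Let $q_e\in Q$ be a relative equilibrium (for instance an equilibrium) of $X_{\lambda_0}$, and let $G_{q_e}$ be its isotropy group, which acts linearly on $T_{q_e}Q$ by $h\cdot v=T_{q_e}\Phi_h(v)$, where $\Phi_h(q)=h\cdot q$. Let $V\subset T_{q_e}Q$ be a $G_{q_e}$-invariant open neighborhood of $0$, contained in the domain of the Riemannian exponential map $\operatorname{Exp}_{q_e}$, which $\operatorname{Exp}_{q_e}$ maps diffeomorphically onto an open set $U\subset Q$; then $U$ is $G_{q_e}$-invariant. Let $\operatorname{Exp}_{q_e}^*X_\lambda$ be the pullback vector field $v\mapsto (T_v\operatorname{Exp}_{q_e})^{-1}X_\lambda(\operatorname{Exp}_{q_e}(v))$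 on $V$. Let $H\subset G_{q_e}$ be a subgroup, and suppose that there are $\epsilon>0$ and a continuous curve $\gamma:[\lambda_0,\lambda_0+\epsilon]\to V$ with $\gamma(\lambda_0)=0$ such that, for every $\lambda\in(\lambda_0,\lambda_0+\epsilon]$, the point $\gamma(\lambda)$ is a relative equilibrium of $\operatorname{Exp}_{q_e}^*X_\lambda$ for the linear $G_{q_e}$-action (that is, $(\operatorname{Exp}_{q_e}^*X_\lambda)(\gamma(\lambda))=\frac{d}{dt}\big|_{t=0}\exp(t\xi)\cdot\gamma(\lambda)$ for some $\xi$ in the Lie algebra of $G_{q_e}$) and its isotropy group in $G_{q_e}$ is conjugate in $G_{q_e}$ to $H$. Then $\operatorname{Exp}_{q_e}\circ\gamma:[\lambda_0,\lambda_0+\epsilon]\to U$ is a continuous curve, and for every $\lambda\in[\lambda_0,\lambda_0+\epsilon]$ the point $\operatorname{Exp}_{q_e}(\gamma(\lambda))$ is a relative equilibrium of $X_\lambda$. For $\lambda>\lambda_0$ the isotropy group of this point under the action of $G_{q_e}$ on $U$ is conjugate in $G_{q_e}$ to $H$. For $\lambda=\lambda_0$ its isotropy group, under the action of $G_{q_e}$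 on $U$ as well as under the action of $G$ on $Q$, is conjugate to $G_{q_e}$. -/

import Mathlib

open Bundle Set MulAction
open scoped Manifold ContDiff Topology

noncomputable section

namespace RelEq

/-! ### Geodesics and the Riemannian exponential map -/

section Riemannian

variable {E : Type*} [NormedAddCommGroup E] [NormedSpace ℝ E]
  {HQ : Type*} [TopologicalSpace HQ] (I : ModelWithCorners ℝ E HQ)
  {Q : Type*} [TopologicalSpace Q] [ChartedSpace HQ Q]
  [RiemannianBundle (fun q : Q ↦ TangentSpace I q)]

/-- The coefficients of the Riemannian metric in the chart `φ` around `x₀`: at a point `y` of the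
chart domain in `E`, the inner product of `Dφ⁻¹(y) a` and `Dφ⁻¹(y) b`. -/
def chartMetric (x₀ : Q) (y a b : E) : ℝ :=
  inner ℝ (mfderiv 𝓘(ℝ, E) I (extChartAt I x₀).symm y a : TangentSpace I ((extChartAt I x₀).symm y))
    (mfderiv 𝓘(ℝ, E) I (extChartAt I x₀).symm y b)

/-- The Christoffel symbols of the first kind of the Levi-Civita connection in the chart
around `x₀`: `Γ(a, b; w) = (∂_a g(b, w) + ∂_b g(a, w) - ∂_w g(a, b)) / 2`. -/
def christoffelFirst (x₀ : Q) (y a b w : E) : ℝ :=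
  (fderiv ℝ (fun z ↦ chartMetric I x₀ z b w) y a
    + fderiv ℝ (fun z ↦ chartMetric I x₀ z a w) y b
    - fderiv ℝ (fun z ↦ chartMetric I x₀ z a b) y w) / 2

/-- `c` is a geodesic on the open set `s` of times: it is smooth there and, in each chart, its
coordinate expression `u` satisfies `g(u'', w) + Γ(u', u'; w) = 0` for all `w`, which is the
equation `u'' + Γ(u', u') = 0` with its index lowered by the metric. -/
def IsGeodesicOn (c : ℝ → Q) (s : Set ℝ) : Prop :=
  ContMDiffOn 𝓘(ℝ, ℝ) I ∞ c s ∧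
  ∀ x₀ : Q, ∀ t ∈ s, c t ∈ (extChartAt I x₀).source →
    ∀ w : E,
      chartMetric I x₀ (extChartAt I x₀ (c t))
          (deriv (deriv (fun r ↦ extChartAt I x₀ (c r))) t) w
        + christoffelFirst I x₀ (extChartAt I x₀ (c t))
          (deriv (fun r ↦ extChartAt I x₀ (c r)) t)
          (deriv (fun r ↦ extChartAt I x₀ (c r)) t) w = 0

/-- `c` is a geodesic, defined on an open interval around `[0, 1]`, that starts at `q` with
initial velocity `v`. -/
def IsGeodesicFrom (q : Q) (v : TangentSpace I q) (c : ℝ → Q) : Prop :=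
  (∃ δ > 0, IsGeodesicOn I c (Ioo (-δ) (1 + δ))) ∧
  (⟨c 0, mfderiv 𝓘(ℝ, ℝ) I c 0 (1 : ℝ)⟩ : TangentBundle I Q) = ⟨q, v⟩

/-- The domain of the Riemannian exponential map at `q`. -/
def expDomain (q : Q) : Set (TangentSpace I q) :=
  {v | ∃ c : ℝ → Q, IsGeodesicFrom I q v c}

open Classical in
/-- The Riemannian exponential map at `q`: the value at time `1` of the geodesic that starts at `q`
with velocity `v`, if that geodesic exists up to time `1` (and `q` otherwise). -/
def Exp (q : Q) (v : TangentSpace I q) : Q :=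
  if h : ∃ c : ℝ → Q, IsGeodesicFrom I q v c then h.choose 1 else q

end Riemannian

/-! ### Group actions, equivariant vector fields and relative equilibria -/

section Action

variable {E : Type*} [NormedAddCommGroup E] [NormedSpace ℝ E]
  {HQ : Type*} [TopologicalSpace HQ] (I : ModelWithCorners ℝ E HQ)
  {Q : Type*} [TopologicalSpace Q] [ChartedSpace HQ Q]
  {F : Type*} [NormedAddCommGroup F] [NormedSpace ℝ F]
  {HG : Type*} [TopologicalSpace HG] (J : ModelWithCorners ℝ F HG)
  {G : Type*} [TopologicalSpace G] [ChartedSpace HG G] [Group G] [MulAction G Q]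

/-- The vector field `X` is smooth. -/
def IsSmoothVectorField [IsManifold I 1 Q] (X : Π q : Q, TangentSpace I q) : Prop :=
  ContMDiff I I.tangent ∞ (fun q ↦ (⟨q, X q⟩ : TangentBundle I Q))

variable (G) in
/-- `X` is `G`-equivariant: `T_q Φ_g (X q) = X (g • q)`. -/
def IsEquivariant (X : Π q : Q, TangentSpace I q) : Prop :=
  ∀ (g : G) (q : Q), mfderiv I I (fun x : Q ↦ g • x) q (X q) = X (g • q)

variable (G Q) in
/-- `G` acts by isometries of the Riemannian metric. -/
def ActsByIsometries [RiemannianBundle (fun q : Q ↦ TangentSpace I q)] : Prop :=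
  ∀ (g : G) (q : Q) (v w : TangentSpace I q),
    inner ℝ (mfderiv I I (fun x : Q ↦ g • x) q v) (mfderiv I I (fun x : Q ↦ g • x) q w)
      = inner ℝ v w

/-- `c` is the curve `t ↦ exp (t ξ)`: the smooth one-parameter subgroup of `G` with
velocity `ξ` at `t = 0`. -/
def IsExpCurve (ξ : GroupLieAlgebra J G) (c : ℝ → G) : Prop :=
  ContMDiff 𝓘(ℝ, ℝ) J ∞ c ∧ (∀ s t : ℝ, c (s + t) = c s * c t) ∧
  (⟨c 0, mfderiv 𝓘(ℝ, ℝ) J c 0 (1 : ℝ)⟩ : TangentBundle J G) = ⟨1, ξ⟩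

variable (G) in
/-- `q` is a relative equilibrium of `X`: for some `ξ` in the Lie algebra of `G`, the derivative
at `t = 0` of `exp (t ξ) • q` is `X q`. (Here `c 0 = 1`.) -/
def IsRelativeEquilibrium (X : Π q : Q, TangentSpace I q) (q : Q) : Prop :=
  ∃ (ξ : GroupLieAlgebra J G) (c : ℝ → G), IsExpCurve J ξ c ∧
    HasMFDerivAt 𝓘(ℝ, ℝ) I (fun t : ℝ ↦ c t • q) 0
      ((1 : ℝ →L[ℝ] ℝ).smulRight (X (c 0 • q)))

/-- The linear action `h · v = T_q Φ_h v` of the isotropy group `G_q` on `T_q Q`. As `h • q = q`,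
the value, an element of `T_{h • q} Q`, is an element of `T_q Q`. -/
def tangentAction {q : Q} (h : stabilizer G q) (v : TangentSpace I q) : TangentSpace I q :=
  (mfderiv I I (fun x : Q ↦ (h : G) • x) q v : TangentSpace I ((h : G) • q))

variable (G) in
/-- The isotropy group of `v ∈ T_q Q` under the linear action of `G_q`. -/
def tangentIsotropy {q : Q} (v : TangentSpace I q) : Set (stabilizer G q) :=
  {h | tangentAction I h v = v}

variable (G) in
/-- `v ∈ T_q Q` is a relative equilibrium, for the linear action of `G_q` on `T_q Q`, of the vector
field `Y`: for some `ξ` in the Lie algebra of `G_q` (that is, `exp (t ξ) ∈ G_q` for all `t`), the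
derivative at `t = 0` of `exp (t ξ) · v` is `Y v`. -/
def IsTangentRelativeEquilibrium
    (q : Q) (Y : TangentSpace I q → TangentSpace I q) (v : TangentSpace I q) : Prop :=
  ∃ (ξ : GroupLieAlgebra J G) (c : ℝ → stabilizer G q), IsExpCurve J ξ (fun t ↦ (c t : G)) ∧
    HasDerivAt (fun t : ℝ ↦ tangentAction I (c t) v) (Y v) 0

/-- The set `S` is a subgroup conjugate to `H` in `Γ`. -/
def IsConjugateTo {Γ : Type*} [Group Γ] (S : Set Γ) (H : Subgroup Γ) : Prop :=
  ∃ g : Γ, S = (H.map (MulAut.conj g).toMonoidHom : Set Γ)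

variable (G) in
/-- `V` is a `G_q`-invariant open neighbourhood of `0` in `T_q Q`, inside the domain of the
Riemannian exponential map at `q`, which maps `V` diffeomorphically onto an open subset of `Q`. -/
structure IsExpNeighborhood [RiemannianBundle (fun q : Q ↦ TangentSpace I q)]
    (q : Q) (V : Set (TangentSpace I q)) : Prop where
  isOpen : IsOpen V
  zero_mem : (0 : TangentSpace I q) ∈ V
  invariant : ∀ (h : stabilizer G q), ∀ v ∈ V, tangentAction I h v ∈ V
  subset_domain : V ⊆ expDomain I q
  injOn : InjOn (Exp I q) V
  isOpen_image : IsOpen (Exp I q '' V)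
  smooth : ContMDiffOn 𝓘(ℝ, TangentSpace I q) I ∞ (Exp I q) V
  smooth_inverse : ∃ Log : Q → TangentSpace I q, LeftInvOn Log (Exp I q) V ∧
    ContMDiffOn I 𝓘(ℝ, TangentSpace I q) ∞ Log (Exp I q '' V)

/-- The pullback `Exp_q^* X`, a vector field on the part of `T_q Q` where `Exp_q` is a local
diffeomorphism: `v ↦ (T_v Exp_q)⁻¹ (X (Exp_q v))`. -/
def expPullback [RiemannianBundle (fun q : Q ↦ TangentSpace I q)]
    (q : Q) (X : Π q : Q, TangentSpace I q) (v : TangentSpace I q) : TangentSpace I q :=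
  VectorField.mpullback 𝓘(ℝ, TangentSpace I q) I (Exp I q) X v

end Action

end RelEq

end

/-! Everything rests on `Exp_tangentAction`: the exponential map at $q_e$ intertwines the linear
action of $G_{q_e}$ with its action on $Q$. An isometry $h$ fixing $q_e$ carries the geodesic with
initial velocity $v$ to the one with initial velocity $h\cdot v$ (`IsGeodesicOn.isometry_comp`), and
a geodesic is determined by its initial velocity (`IsGeodesicFrom.eq_at_one`).

Equivariance and injectivity on $V$ make the isotropy groups of $v$ and of its image equal
(`tangentIsotropy_eq`). Differentiating $\operatorname{Exp}(\exp(t\xi)\cdot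
v)=\exp(t\xi)\cdot\operatorname{Exp}(v)$ at $t=0$ carries relative equilibria of the pullback to
relative equilibria of $X_\lambda$ with the same $\xi$. At $\lambda_0$ the point is
$\operatorname{Exp}(0)=q_e$ itself.

The geodesic facts are proved in charts: the Christoffel symbols transform so that isometries
preserve the geodesic equation, and inverting the metric turns it into a locally Lipschitz
first-order system. -/

namespace RelEq

/-! ### The geodesic equation on a vector space -/

section Coordinates

set_option synthInstance.maxHeartbeats 400000

variable {E : Type*} [NormedAddCommGroup E] [NormedSpace ℝ E]

/-- The Christoffel symbols of the first kind of a field `g` of bilinear forms on a vector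
space. -/
noncomputable def christoffelForm (g : E → E →L[ℝ] E →L[ℝ] ℝ) (y a b w : E) : ℝ :=
  (fderiv ℝ g y a b w + fderiv ℝ g y b a w - fderiv ℝ g y w a b) / 2

theorem christoffelForm_zero (g : E → E →L[ℝ] E →L[ℝ] ℝ) (y w : E) :
    christoffelForm g y 0 0 w = 0 := by
  simp [christoffelForm]

theorem hasFDerivAt_apply_apply {g : E → E →L[ℝ] E →L[ℝ] ℝ} {g' : E →L[ℝ] E →L[ℝ] E →L[ℝ] ℝ}
    {y : E} (h : HasFDerivAt g g' y) (a b : E) :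
    HasFDerivAt (fun z ↦ g z a b) ((g'.flip a).flip b) y := by
  have := (h.clm_apply (hasFDerivAt_const a y)).clm_apply (hasFDerivAt_const b y)
  refine this.congr_fderiv (ContinuousLinearMap.ext fun _ ↦ ?_)
  simp

/-- The derivative of the pullback of a field of bilinear forms. -/
theorem fderiv_pullback_form {g₀ g₁ : E → E →L[ℝ] E →L[ℝ] ℝ} {ψ : E → E} {y : E}
    (hψ : ContDiffAt ℝ 2 ψ y) (hg₀ : DifferentiableAt ℝ g₀ y)
    (hg₁ : DifferentiableAt ℝ g₁ (ψ y))
    (h : ∀ᶠ z in 𝓝 y, ∀ a b, g₀ z a b = g₁ (ψ z) (fderiv ℝ ψ z a) (fderiv ℝ ψ z b))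
    (c a b : E) :
    fderiv ℝ g₀ y c a b =
      fderiv ℝ g₁ (ψ y) (fderiv ℝ ψ y c) (fderiv ℝ ψ y a) (fderiv ℝ ψ y b)
        + g₁ (ψ y) (fderiv ℝ (fderiv ℝ ψ) y c a) (fderiv ℝ ψ y b)
        + g₁ (ψ y) (fderiv ℝ ψ y a) (fderiv ℝ (fderiv ℝ ψ) y c b) := by
  have hψ' : HasFDerivAt ψ (fderiv ℝ ψ y) y :=
    (hψ.differentiableAt (by norm_num)).hasFDerivAt
  have hD : HasFDerivAt (fderiv ℝ ψ) (fderiv ℝ (fderiv ℝ ψ) y) y :=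
    ((hψ.fderiv_right (m := 1) (by norm_num)).differentiableAt (by norm_num)).hasFDerivAt
  have h0 : HasFDerivAt (fun z ↦ g₀ z a b)
      (((fderiv ℝ g₀ y).flip a).flip b) y :=
    hasFDerivAt_apply_apply hg₀.hasFDerivAt a b
  have h1 : HasFDerivAt (fun z ↦ g₀ z a b) _ y :=
    (((hg₁.hasFDerivAt.comp y hψ').clm_apply (hD.clm_apply (hasFDerivAt_const a y))).clm_apply
      (hD.clm_apply (hasFDerivAt_const b y))).congr_of_eventuallyEq
      (h.mono fun z hz ↦ by simpa using hz a b)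
  have := congrArg (fun L : E →L[ℝ] ℝ ↦ L c) (h0.unique h1)
  simp at this
  rw [this]; ring

/-- Transformation law of the Christoffel symbols under a local isometry. -/
theorem christoffelForm_pullback {g₀ g₁ : E → E →L[ℝ] E →L[ℝ] ℝ} {ψ : E → E} {y : E}
    (hψ : ContDiffAt ℝ 2 ψ y) (hg₀ : DifferentiableAt ℝ g₀ y)
    (hg₁ : DifferentiableAt ℝ g₁ (ψ y)) (hsymm : ∀ a b, g₁ (ψ y) a b = g₁ (ψ y) b a)
    (h : ∀ᶠ z in 𝓝 y, ∀ a b, g₀ z a b = g₁ (ψ z) (fderiv ℝ ψ z a) (fderiv ℝ ψ z b))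
    (a b w : E) :
    christoffelForm g₀ y a b w =
      christoffelForm g₁ (ψ y) (fderiv ℝ ψ y a) (fderiv ℝ ψ y b) (fderiv ℝ ψ y w)
        + g₁ (ψ y) (fderiv ℝ (fderiv ℝ ψ) y a b) (fderiv ℝ ψ y w) := by
  -- Of the six terms with a second derivative of `ψ`, the two containing `D²ψ(a, b)` add up; the
  -- other four cancel in pairs by symmetry of `D²ψ` and of `g₁`.
  have hs : IsSymmSndFDerivAt ℝ ψ y := hψ.isSymmSndFDerivAt (by simp)
  unfold christoffelForm
  rw [fderiv_pullback_form hψ hg₀ hg₁ h, fderiv_pullback_form hψ hg₀ hg₁ h,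
    fderiv_pullback_form hψ hg₀ hg₁ h, hs.eq b a, hs.eq w a, hs.eq w b,
    hsymm (fderiv ℝ ψ y b) (fderiv ℝ (fderiv ℝ ψ) y a w)]
  ring

theorem contDiffAt_deriv {u : ℝ → E} {t : ℝ} (hu : ContDiffAt ℝ 2 u t) :
    ContDiffAt ℝ 1 (deriv u) t :=
  hu.derivWithin (by norm_num)

/-- The second derivative of a curve composed with a map. -/
theorem deriv_deriv_comp {ψ : E → E} {u : ℝ → E} {t : ℝ} (hu : ContDiffAt ℝ 2 u t)
    (hψ : ContDiffAt ℝ 2 ψ (u t)) :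
    deriv (fun r ↦ ψ (u r)) t = fderiv ℝ ψ (u t) (deriv u t) ∧
    deriv (deriv (fun r ↦ ψ (u r))) t =
      fderiv ℝ (fderiv ℝ ψ) (u t) (deriv u t) (deriv u t)
        + fderiv ℝ ψ (u t) (deriv (deriv u) t) := by
  have h1 : ∀ᶠ r in 𝓝 t, deriv (fun r ↦ ψ (u r)) r = fderiv ℝ ψ (u r) (deriv u r) := by
    filter_upwards [hu.eventually (by simp), hu.continuousAt.eventually (hψ.eventually (by simp))]
      with r hr hr'
    exact ((hr'.differentiableAt (by norm_num)).hasFDerivAt.comp_hasDerivAt r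
      (hr.differentiableAt (by norm_num)).hasDerivAt).deriv
  refine ⟨h1.self_of_nhds, ?_⟩
  rw [Filter.EventuallyEq.deriv_eq h1]
  have hD : HasFDerivAt (fderiv ℝ ψ) (fderiv ℝ (fderiv ℝ ψ) (u t)) (u t) :=
    ((hψ.fderiv_right (m := 1) (by norm_num)).differentiableAt (by norm_num)).hasFDerivAt
  have hu1 : HasDerivAt u (deriv u t) t := (hu.differentiableAt (by norm_num)).hasDerivAt
  have hu2 : HasDerivAt (deriv u) (deriv (deriv u) t) t :=
    ((contDiffAt_deriv hu).differentiableAt (by norm_num)).hasDerivAt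
  exact ((hD.comp_hasDerivAt t hu1).clm_apply hu2).deriv

/-- A local isometry maps solutions of the geodesic equation to solutions. -/
theorem geodesic_equation_comp {g₀ g₁ : E → E →L[ℝ] E →L[ℝ] ℝ} {ψ : E → E} {u : ℝ → E} {t : ℝ}
    (hu : ContDiffAt ℝ 2 u t) (hψ : ContDiffAt ℝ 2 ψ (u t))
    (hg₀ : DifferentiableAt ℝ g₀ (u t)) (hg₁ : DifferentiableAt ℝ g₁ (ψ (u t)))
    (hsymm : ∀ a b, g₁ (ψ (u t)) a b = g₁ (ψ (u t)) b a)
    (h : ∀ᶠ z in 𝓝 (u t), ∀ a b, g₀ z a b = g₁ (ψ z) (fderiv ℝ ψ z a) (fderiv ℝ ψ z b))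
    {w : E} (hgeo : g₀ (u t) (deriv (deriv u) t) w
      + christoffelForm g₀ (u t) (deriv u t) (deriv u t) w = 0) :
    g₁ (ψ (u t)) (deriv (deriv (fun r ↦ ψ (u r))) t) (fderiv ℝ ψ (u t) w)
      + christoffelForm g₁ (ψ (u t)) (deriv (fun r ↦ ψ (u r)) t) (deriv (fun r ↦ ψ (u r)) t)
        (fderiv ℝ ψ (u t) w) = 0 := by
  obtain ⟨h1, h2⟩ := deriv_deriv_comp hu hψ
  -- The term `D²ψ(u', u')` in the acceleration of `ψ ∘ u` cancels the inhomogeneous term of the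
  -- transformation law.
  rw [h1, h2, ← hgeo, christoffelForm_pullback hψ hg₀ hg₁ hsymm h, h.self_of_nhds]
  simp only [map_add, add_apply]
  ring

variable [FiniteDimensional ℝ E]

/-- A definite bilinear form on a finite-dimensional space is invertible. -/
theorem isInvertible_of_definite {g : E →L[ℝ] E →L[ℝ] ℝ} (hg : ∀ a, a ≠ 0 → g a a ≠ 0) :
    g.IsInvertible := by
  have hinj : Function.Injective g.toLinearMap := by
    rw [← LinearMap.ker_eq_bot, LinearMap.ker_eq_bot']
    intro a ha
    by_contra h
    exact hg a h (by simpa using congrArg (fun L : E →L[ℝ] ℝ ↦ L a) ha)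
  have hdim : Module.finrank ℝ E = Module.finrank ℝ (E →L[ℝ] ℝ) := by
    rw [← (LinearMap.toContinuousLinearMap (𝕜 := ℝ) (E := E) (F' := ℝ)).finrank_eq]
    exact (Subspace.dual_finrank_eq).symm
  exact ⟨(LinearEquiv.ofInjectiveOfFinrankEq g.toLinearMap hinj hdim).toContinuousLinearEquiv,
    by ext; rfl⟩

/-- The Christoffel symbols of the first kind, as a linear form. -/
noncomputable def christoffelDual (g : E → E →L[ℝ] E →L[ℝ] ℝ) (y p : E) : E →L[ℝ] ℝ :=
  fderiv ℝ g y p p - (2⁻¹ : ℝ) • (((fderiv ℝ g y).flip p).flip p)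

/-- The acceleration of a geodesic as a function of its position and velocity. -/
noncomputable def geodesicAcceleration (g : E → E →L[ℝ] E →L[ℝ] ℝ) (z : E × E) : E :=
  -(g z.1).inverse (christoffelDual g z.1 z.2)

/-- A definite form is invertible, so the index can be raised again and the acceleration solved for.
On equal arguments the first two Christoffel terms coincide, which explains the form of
`christoffelDual`. -/
theorem eq_geodesicAcceleration {g : E → E →L[ℝ] E →L[ℝ] ℝ} {y p a : E}
    (hg : ∀ a, a ≠ 0 → g y a a ≠ 0) (h : ∀ w, g y a w + christoffelForm g y p p w = 0) :
    a = geodesicAcceleration g (y, p) := by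
  have hga : g y a = -christoffelDual g y p := by
    ext w
    have := h w
    simp only [christoffelForm, christoffelDual, neg_apply,
      sub_apply, smul_apply,
      ContinuousLinearMap.flip_apply, smul_eq_mul] at this ⊢
    linarith
  rw [geodesicAcceleration, ← map_neg, ← hga, (isInvertible_of_definite hg).inverse_apply_self]

omit [FiniteDimensional ℝ E] in
theorem contDiffAt_fderiv_fst_apply {W : Type*} [NormedAddCommGroup W] [NormedSpace ℝ W]
    {g : E → W} {q : E × E → E} {z : E × E} (hg : ContDiffAt ℝ 2 g z.1)
    (hq : ContDiffAt ℝ 1 q z) : ContDiffAt ℝ 1 (fun z : E × E ↦ fderiv ℝ g z.1 (q z)) z :=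
  (ContDiffAt.comp z (g := fderiv ℝ g) (hg.fderiv_right (by norm_num)) contDiffAt_fst).clm_apply hq

/-- In finite dimension an operator is determined, linearly and continuously, by its values on a
basis. -/
theorem contDiffAt_clm_apply_iff {D W : Type*} [NormedAddCommGroup D] [NormedSpace ℝ D]
    [NormedAddCommGroup W] [NormedSpace ℝ W] {n : ℕ∞ω} {f : D → E →L[ℝ] W} {x : D} :
    ContDiffAt ℝ n f x ↔ ∀ a, ContDiffAt ℝ n (fun y ↦ f y a) x := by
  refine ⟨fun h a ↦ h.clm_apply contDiffAt_const, fun h ↦ ?_⟩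
  let d := Module.finrank ℝ E
  let e₁ : E ≃L[ℝ] Fin d → ℝ := ContinuousLinearEquiv.ofFinrankEq
    (Module.finrank_fin_fun ℝ).symm
  let e₂ := (e₁.arrowCongr (1 : W ≃L[ℝ] W)).trans (ContinuousLinearEquiv.piRing (Fin d))
  rw [← Function.id_comp f, ← e₂.symm_comp_self]
  exact e₂.symm.contDiff.contDiffAt.comp x (contDiffAt_pi.mpr fun i ↦ h _)

theorem contDiffAt_christoffelDual {g : E → E →L[ℝ] E →L[ℝ] ℝ} {z : E × E}
    (hg : ContDiffAt ℝ 2 g z.1) :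
    ContDiffAt ℝ 1 (fun z : E × E ↦ christoffelDual g z.1 z.2) z := by
  rw [contDiffAt_clm_apply_iff]
  intro w
  have hsnd : ContDiffAt ℝ 1 (Prod.snd : E × E → E) z := contDiffAt_snd
  have hw : ContDiffAt ℝ 1 (fun _ : E × E ↦ w) z := contDiffAt_const
  have h1 := ((contDiffAt_fderiv_fst_apply hg hsnd).clm_apply hsnd).clm_apply hw
  have h2 := ((contDiffAt_fderiv_fst_apply hg hw).clm_apply hsnd).clm_apply hsnd
  exact h1.sub (contDiffAt_const (c := (2⁻¹ : ℝ)) |>.smul h2)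

/-- Inversion is smooth at invertible operators, and the Christoffel symbols cost one derivative of
`g`. Class $C^1$ gives the local Lipschitz bound for ODE uniqueness. -/
theorem contDiffAt_geodesicAcceleration {g : E → E →L[ℝ] E →L[ℝ] ℝ} {z : E × E}
    (hg : ContDiffAt ℝ 2 g z.1) (hpos : ∀ a, a ≠ 0 → g z.1 a a ≠ 0) :
    ContDiffAt ℝ 1 (geodesicAcceleration g) z := by
  have hinv : ContDiffAt ℝ 1 (fun z : E × E ↦ (g z.1).inverse) z :=
    ContDiffAt.comp z (g := ContinuousLinearMap.inverse)
      (isInvertible_of_definite hpos).contDiffAt_map_inverse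
      (ContDiffAt.comp z (g := g) (hg.of_le (by norm_num)) contDiffAt_fst)
  exact (hinv.clm_apply (contDiffAt_christoffelDual hg)).neg

/-- Local uniqueness for the geodesic equation. -/
theorem geodesic_equation_unique {g : E → E →L[ℝ] E →L[ℝ] ℝ} {u₁ u₂ : ℝ → E} {t : ℝ}
    (hu₁ : ContDiffAt ℝ 2 u₁ t) (hu₂ : ContDiffAt ℝ 2 u₂ t)
    (hg : ContDiffAt ℝ 2 g (u₁ t)) (hpos : ∀ᶠ y in 𝓝 (u₁ t), ∀ a, a ≠ 0 → g y a a ≠ 0)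
    (h₁ : ∀ᶠ r in 𝓝 t, ∀ w, g (u₁ r) (deriv (deriv u₁) r) w
      + christoffelForm g (u₁ r) (deriv u₁ r) (deriv u₁ r) w = 0)
    (h₂ : ∀ᶠ r in 𝓝 t, ∀ w, g (u₂ r) (deriv (deriv u₂) r) w
      + christoffelForm g (u₂ r) (deriv u₂ r) (deriv u₂ r) w = 0)
    (heq : u₁ t = u₂ t) (hderiv : deriv u₁ t = deriv u₂ t) : u₁ =ᶠ[𝓝 t] u₂ := by
  -- The second-order equation becomes an autonomous first-order system for `(u, u')`, Lipschitz on
  -- a neighbourhood `s` of the common initial state.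
  obtain ⟨K, s, hs, hL⟩ := ((contDiffAt_snd (𝕜 := ℝ) (n := 1)).prodMk
    (contDiffAt_geodesicAcceleration (z := (u₁ t, deriv u₁ t)) hg
      hpos.self_of_nhds)).exists_lipschitzOnWith
  have key : ∀ u : ℝ → E, ContDiffAt ℝ 2 u t → u t = u₁ t → deriv u t = deriv u₁ t →
      (∀ᶠ r in 𝓝 t, ∀ w, g (u r) (deriv (deriv u) r) w
        + christoffelForm g (u r) (deriv u r) (deriv u r) w = 0) →
      ∀ᶠ r in 𝓝 t, HasDerivAt (fun r ↦ (u r, deriv u r))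
        (deriv u r, geodesicAcceleration g (u r, deriv u r)) r ∧
        (u r, deriv u r) ∈ s := by
    intro u hu h0 h1 hgeo
    have hcd : ContinuousAt (fun r ↦ (u r, deriv u r)) t :=
      hu.continuousAt.prodMk (contDiffAt_deriv hu).continuousAt
    have hmem : ∀ᶠ r in 𝓝 t, (u r, deriv u r) ∈ s :=
      hcd.eventually (by simp only [h0, h1]; exact hs)
    have hp : ∀ᶠ r in 𝓝 t, ∀ a, a ≠ 0 → g (u r) a a ≠ 0 :=
      hu.continuousAt.eventually (by rw [h0]; exact hpos)
    filter_upwards [hmem, hp, hgeo, hu.eventually (by simp)] with r hr hpr hgr hur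
    refine ⟨?_, hr⟩
    have := eq_geodesicAcceleration hpr hgr
    rw [← this]
    exact (hur.differentiableAt (by norm_num)).hasDerivAt.prodMk
      ((contDiffAt_deriv hur).differentiableAt (by norm_num)).hasDerivAt
  have := ODE_solution_unique_of_eventually (s := fun _ ↦ s)
    (v := fun _ z ↦ (z.2, geodesicAcceleration g z)) (.of_forall fun _ ↦ hL)
    (key u₁ hu₁ rfl rfl h₁) (key u₂ hu₂ heq.symm hderiv.symm h₂) (by simp [heq, hderiv])
  exact this.mono fun r hr ↦ congrArg Prod.fst hr

end Coordinates

end RelEq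

namespace RelEq

/-! ### Derivatives of charts -/

section ChartDerivative

variable {E : Type*} [NormedAddCommGroup E] [NormedSpace ℝ E]
  {HQ : Type*} [TopologicalSpace HQ] (I : ModelWithCorners ℝ E HQ)
  {Q : Type*} [TopologicalSpace Q] [ChartedSpace HQ Q]

/-- The derivative of the chart around `x₀`, as an endomorphism of the model space. -/
noncomputable def chartDeriv (x₀ x : Q) : E →L[ℝ] E :=
  mfderiv I 𝓘(ℝ, E) (extChartAt I x₀) x

/-- The derivative of the inverse of the chart around `x₀`, as an endomorphism of the
model space. -/
noncomputable def chartSymmDeriv (x₀ : Q) (y : E) : E →L[ℝ] E :=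
  mfderiv 𝓘(ℝ, E) I (extChartAt I x₀).symm y

variable [I.Boundaryless] [IsManifold I ∞ Q]

/-- This links the chart to the tangent bundle trivialization, through which smoothness of the
metric is accessible. -/
theorem chartSymmDeriv_eq_symmL {x₀ : Q} {y : E} (hy : y ∈ (extChartAt I x₀).target) :
    chartSymmDeriv I x₀ y =
      (trivializationAt E (TangentSpace I) x₀).symmL ℝ ((extChartAt I x₀).symm y) := by
  have hx : (extChartAt I x₀).symm y ∈ (chartAt HQ x₀).source := by
    rw [← extChartAt_source I x₀]; exact (extChartAt I x₀).map_target hy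
  rw [TangentBundle.symmL_trivializationAt hx, I.range_eq_univ, mfderivWithin_univ,
    (extChartAt I x₀).right_inv hy]
  rfl

theorem chartSymmDeriv_chartDeriv {x₀ x : Q} (hx : x ∈ (extChartAt I x₀).source) (v : E) :
    chartSymmDeriv I x₀ (extChartAt I x₀ x) (chartDeriv I x₀ x v) = v := by
  have h := mfderivWithin_extChartAt_symm_comp_mfderiv_extChartAt' (I := I) hx
  rw [I.range_eq_univ, mfderivWithin_univ] at h
  exact congrArg (fun L : E →L[ℝ] E ↦ L v) h

theorem chartDeriv_chartSymmDeriv {x₀ : Q} {y : E} (hy : y ∈ (extChartAt I x₀).target) (v : E) :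
    chartDeriv I x₀ ((extChartAt I x₀).symm y) (chartSymmDeriv I x₀ y v) = v := by
  have h := mfderiv_extChartAt_comp_mfderivWithin_extChartAt_symm (I := I) hy
  rw [I.range_eq_univ, mfderivWithin_univ] at h
  exact congrArg (fun L : E →L[ℝ] E ↦ L v) h

end ChartDerivative

/-! ### The metric in a chart -/

section ChartForm

variable {E : Type*} [NormedAddCommGroup E] [NormedSpace ℝ E]
  {HQ : Type*} [TopologicalSpace HQ] (I : ModelWithCorners ℝ E HQ)
  {Q : Type*} [TopologicalSpace Q] [ChartedSpace HQ Q]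
  [RiemannianBundle (fun q : Q ↦ TangentSpace I q)]

/-- The inner product of two vectors of the model space, seen as tangent vectors at `x`. -/
noncomputable def metricAt (x : Q) (a b : E) : ℝ :=
  @inner ℝ (TangentSpace I x) _ a b

theorem metricAt_comm (x : Q) (a b : E) : metricAt I x a b = metricAt I x b a :=
  real_inner_comm (F := TangentSpace I x) _ _

theorem metricAt_self_ne_zero (x : Q) {a : E} (ha : a ≠ 0) : metricAt I x a a ≠ 0 :=
  inner_self_ne_zero (𝕜 := ℝ) (E := TangentSpace I x) |>.2 ha

/-- The metric as a bilinear form on the model space. -/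
noncomputable def metricForm (x : Q) : E →ₗ[ℝ] E →ₗ[ℝ] ℝ :=
  LinearMap.mk₂ ℝ (metricAt I x) (fun a b c ↦ inner_add_left (E := TangentSpace I x) a b c)
    (fun r a b ↦ real_inner_smul_left (F := TangentSpace I x) a b r)
    (fun a b c ↦ inner_add_right (E := TangentSpace I x) a b c)
    (fun r a b ↦ real_inner_smul_right (F := TangentSpace I x) a b r)

variable [FiniteDimensional ℝ E]

/-- The coefficients of the metric in the chart around `x₀`, as a field of bilinear forms. -/
noncomputable def chartForm (x₀ : Q) (y : E) : E →L[ℝ] E →L[ℝ] ℝ :=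
  LinearMap.toContinuousBilinearMap
    ((metricForm I ((extChartAt I x₀).symm y)).compl₁₂
      (chartSymmDeriv I x₀ y).toLinearMap (chartSymmDeriv I x₀ y).toLinearMap)

theorem chartForm_apply (x₀ : Q) (y a b : E) :
    chartForm I x₀ y a b =
      metricAt I ((extChartAt I x₀).symm y) (chartSymmDeriv I x₀ y a) (chartSymmDeriv I x₀ y b) :=
  rfl

theorem chartForm_eq_chartMetric (x₀ : Q) (y a b : E) :
    chartForm I x₀ y a b = chartMetric I x₀ y a b :=
  rfl

theorem chartForm_comm (x₀ : Q) (y a b : E) : chartForm I x₀ y a b = chartForm I x₀ y b a :=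
  metricAt_comm I _ _ _

variable [I.Boundaryless] [IsManifold I ∞ Q]

/-- The coefficients are inner products of the coordinate vector fields, which are smooth because
they are constant in the trivialization. -/
theorem contDiffAt_chartForm {x₀ : Q} {y : E} (hy : y ∈ (extChartAt I x₀).target)
    [IsContMDiffRiemannianBundle I ∞ E (fun q : Q ↦ TangentSpace I q)] :
    ContDiffAt ℝ ∞ (chartForm I x₀) y := by
  rw [contDiffAt_clm_apply_iff]
  intro a
  rw [contDiffAt_clm_apply_iff]
  intro b
  set e := trivializationAt E (TangentSpace I) x₀ with he
  have hmem : ∀ y ∈ (extChartAt I x₀).target, (extChartAt I x₀).symm y ∈ e.baseSet := by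
    intro y hy
    rw [he, TangentBundle.trivializationAt_baseSet, ← extChartAt_source I x₀]
    exact (extChartAt I x₀).map_target hy
  have hsec : ∀ a : E, ContMDiffOn 𝓘(ℝ, E) I.tangent ∞
      (fun y ↦ (⟨(extChartAt I x₀).symm y, e.symm ((extChartAt I x₀).symm y) a⟩ :
        TangentBundle I Q)) (extChartAt I x₀).target := by
    intro a
    have h1 : ContMDiffOn 𝓘(ℝ, E) (I.prod 𝓘(ℝ, E)) ∞
        (fun y ↦ ((extChartAt I x₀).symm y, a)) (extChartAt I x₀).target :=
      (contMDiffOn_extChartAt_symm x₀).prodMk contMDiffOn_const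
    have h2 := (e.contMDiffOn_symm (IB := I) (n := ∞)).comp h1
      (fun y hy ↦ by simpa [e.mem_target] using hmem y hy)
    refine h2.congr fun y hy ↦ ?_
    simp only [Function.comp]
    rw [← e.mk_symm (hmem y hy)]
  have h : ContMDiffOn 𝓘(ℝ, E) 𝓘(ℝ) ∞ (fun y ↦ metricAt I ((extChartAt I x₀).symm y)
      (e.symm ((extChartAt I x₀).symm y) a) (e.symm ((extChartAt I x₀).symm y) b))
      (extChartAt I x₀).target :=
    ContMDiffOn.inner_bundle (IB := I) (F := E) (E := fun q : Q ↦ TangentSpace I q)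
      (b := (extChartAt I x₀).symm) (v := fun y ↦ e.symm ((extChartAt I x₀).symm y) a)
      (w := fun y ↦ e.symm ((extChartAt I x₀).symm y) b) (hsec a) (hsec b)
  have h' : ContDiffOn ℝ ∞ (fun y ↦ chartForm I x₀ y a b) (extChartAt I x₀).target := by
    refine h.contDiffOn.congr fun y hy ↦ ?_
    have happ : ∀ c, chartSymmDeriv I x₀ y c = e.symm ((extChartAt I x₀).symm y) c := fun c ↦ by
      rw [chartSymmDeriv_eq_symmL I hy]
      exact Trivialization.symmL_apply _ (hmem y hy) _
    rw [chartForm_apply, happ, happ]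
  exact h'.contDiffAt ((isOpen_extChartAt_target x₀).mem_nhds hy)

theorem christoffelFirst_eq_christoffelForm {x₀ : Q} {y : E} (hy : y ∈ (extChartAt I x₀).target)
    [IsContMDiffRiemannianBundle I ∞ E (fun q : Q ↦ TangentSpace I q)] (a b w : E) :
    christoffelFirst I x₀ y a b w = christoffelForm (chartForm I x₀) y a b w := by
  have key : ∀ a b c : E, fderiv ℝ (fun z ↦ chartMetric I x₀ z a b) y c =
      fderiv ℝ (chartForm I x₀) y c a b := by
    intro a b c
    exact congrArg (fun L : E →L[ℝ] ℝ ↦ L c) (hasFDerivAt_apply_apply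
      ((contDiffAt_chartForm I hy).differentiableAt (by simp)).hasFDerivAt a b).fderiv
  simp only [christoffelFirst, christoffelForm, key]

theorem chartForm_self_ne_zero {x₀ : Q} {y : E} (hy : y ∈ (extChartAt I x₀).target) {a : E}
    (ha : a ≠ 0) : chartForm I x₀ y a a ≠ 0 := by
  refine metricAt_self_ne_zero I _ fun h ↦ ha ?_
  have h' : chartSymmDeriv I x₀ y a = 0 := h
  rw [← chartDeriv_chartSymmDeriv I hy a, h', map_zero]

end ChartForm

end RelEq

namespace RelEq

/-! ### Maps and curves in charts -/

section ChartExpression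

variable {E : Type*} [NormedAddCommGroup E] [NormedSpace ℝ E]
  {HQ : Type*} [TopologicalSpace HQ] (I : ModelWithCorners ℝ E HQ)
  {Q : Type*} [TopologicalSpace Q] [ChartedSpace HQ Q]

/-- The derivative of a self-map of a manifold, as an endomorphism of the model space. -/
noncomputable def selfDeriv (f : Q → Q) (x : Q) : E →L[ℝ] E :=
  mfderiv I I f x

/-- The expression of `f` in the charts around `x₀` and `x₁`. -/
noncomputable def chartExpression (f : Q → Q) (x₀ x₁ : Q) (y : E) : E :=
  extChartAt I x₁ (f ((extChartAt I x₀).symm y))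

variable [I.Boundaryless] [IsManifold I ∞ Q]

theorem contDiffAt_chartExpression {f : Q → Q} (hf : ContMDiff I I ∞ f) {x₀ x₁ : Q} {y : E}
    (hy : y ∈ (extChartAt I x₀).target)
    (hfy : f ((extChartAt I x₀).symm y) ∈ (extChartAt I x₁).source) :
    ContDiffAt ℝ ∞ (chartExpression I f x₀ x₁) y := by
  rw [← contMDiffAt_iff_contDiffAt]
  have h0 : ContMDiffAt 𝓘(ℝ, E) I ∞ (extChartAt I x₀).symm y :=
    (contMDiffOn_extChartAt_symm x₀).contMDiffAt ((isOpen_extChartAt_target x₀).mem_nhds hy)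
  have h1 : ContMDiffAt I 𝓘(ℝ, E) ∞ (extChartAt I x₁) (f ((extChartAt I x₀).symm y)) :=
    contMDiffAt_extChartAt' (by rwa [← extChartAt_source I])
  exact h1.comp y (hf.contMDiffAt.comp y h0)

theorem fderiv_chartExpression {f : Q → Q} (hf : ContMDiff I I ∞ f) {x₀ x₁ : Q} {y : E}
    (hy : y ∈ (extChartAt I x₀).target)
    (hfy : f ((extChartAt I x₀).symm y) ∈ (extChartAt I x₁).source) (a : E) :
    fderiv ℝ (chartExpression I f x₀ x₁) y a =
      chartDeriv I x₁ (f ((extChartAt I x₀).symm y))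
        (selfDeriv I f ((extChartAt I x₀).symm y) (chartSymmDeriv I x₀ y a)) := by
  have h0 : MDifferentiableAt 𝓘(ℝ, E) I (extChartAt I x₀).symm y :=
    ((contMDiffOn_extChartAt_symm (n := ∞) x₀).contMDiffAt
      ((isOpen_extChartAt_target x₀).mem_nhds hy)).mdifferentiableAt (by simp)
  have h1 : MDifferentiableAt I 𝓘(ℝ, E) (extChartAt I x₁) (f ((extChartAt I x₀).symm y)) :=
    mdifferentiableAt_extChartAt (by rwa [← extChartAt_source I])
  have h : HasMFDerivAt 𝓘(ℝ, E) 𝓘(ℝ, E) (chartExpression I f x₀ x₁) y _ := h1.hasMFDerivAt.comp y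
    (((hf.mdifferentiable (by simp)) _).hasMFDerivAt.comp y h0.hasMFDerivAt)
  rw [← mfderiv_eq_fderiv]
  exact congrArg (fun L : E →L[ℝ] E ↦ L a) h.mfderiv

omit [I.Boundaryless] in
theorem contDiffAt_curve_in_chart {c : ℝ → Q} {s : Set ℝ} (hs : IsOpen s)
    (hc : ContMDiffOn 𝓘(ℝ, ℝ) I ∞ c s) {x₀ : Q} {t : ℝ} (ht : t ∈ s)
    (hct : c t ∈ (extChartAt I x₀).source) :
    ContDiffAt ℝ 2 (fun r ↦ extChartAt I x₀ (c r)) t := by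
  rw [← contMDiffAt_iff_contDiffAt]
  have h1 : ContMDiffAt I 𝓘(ℝ, E) 2 (extChartAt I x₀) (c t) :=
    contMDiffAt_extChartAt' (by rwa [← extChartAt_source I])
  exact h1.comp t ((hc.contMDiffAt (hs.mem_nhds ht)).of_le ENat.LEInfty.out)

end ChartExpression

/-! ### Isometries and uniqueness of geodesics -/

section Geodesics

variable {E : Type*} [NormedAddCommGroup E] [NormedSpace ℝ E] [FiniteDimensional ℝ E]
  {HQ : Type*} [TopologicalSpace HQ] (I : ModelWithCorners ℝ E HQ) [I.Boundaryless]
  {Q : Type*} [TopologicalSpace Q] [ChartedSpace HQ Q] [IsManifold I ∞ Q]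
  [RiemannianBundle (fun q : Q ↦ TangentSpace I q)]

/-- By the chain rule the chart derivatives cancel, leaving the isometry condition on `Q`. -/
theorem chartForm_chartExpression {f : Q → Q} (hf : ContMDiff I I ∞ f)
    (hiso : ∀ x a b, metricAt I (f x) (selfDeriv I f x a) (selfDeriv I f x b) = metricAt I x a b)
    {x₀ x₁ : Q} {y : E} (hy : y ∈ (extChartAt I x₀).target)
    (hfy : f ((extChartAt I x₀).symm y) ∈ (extChartAt I x₁).source) (a b : E) :
    chartForm I x₀ y a b = chartForm I x₁ (chartExpression I f x₀ x₁ y)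
      (fderiv ℝ (chartExpression I f x₀ x₁) y a) (fderiv ℝ (chartExpression I f x₀ x₁) y b) := by
  rw [fderiv_chartExpression I hf hy hfy, fderiv_chartExpression I hf hy hfy, chartForm_apply,
    chartForm_apply, chartExpression, chartSymmDeriv_chartDeriv I hfy,
    chartSymmDeriv_chartDeriv I hfy, (extChartAt I x₁).left_inv hfy, hiso]

variable [IsContMDiffRiemannianBundle I ∞ E (fun q : Q ↦ TangentSpace I q)]

theorem IsGeodesicOn.chartForm_equation {c : ℝ → Q} {s : Set ℝ} (hc : IsGeodesicOn I c s)
    {x₀ : Q} {t : ℝ} (ht : t ∈ s) (hct : c t ∈ (extChartAt I x₀).source) (w : E) :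
    chartForm I x₀ (extChartAt I x₀ (c t)) (deriv (deriv (fun r ↦ extChartAt I x₀ (c r))) t) w
      + christoffelForm (chartForm I x₀) (extChartAt I x₀ (c t))
        (deriv (fun r ↦ extChartAt I x₀ (c r)) t) (deriv (fun r ↦ extChartAt I x₀ (c r)) t) w
      = 0 := by
  rw [chartForm_eq_chartMetric,
    ← christoffelFirst_eq_christoffelForm I ((extChartAt I x₀).map_source hct)]
  exact hc.2 x₀ t ht hct w

/-- An isometric smooth map sends geodesics to geodesics. -/
theorem IsGeodesicOn.isometry_comp {f : Q → Q} (hf : ContMDiff I I ∞ f)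
    (hiso : ∀ x a b, metricAt I (f x) (selfDeriv I f x a) (selfDeriv I f x b) = metricAt I x a b)
    {c : ℝ → Q} {s : Set ℝ} (hs : IsOpen s) (hc : IsGeodesicOn I c s) :
    IsGeodesicOn I (fun t ↦ f (c t)) s := by
  refine ⟨hf.comp_contMDiffOn hc.1, fun x₁ t ht hfct w ↦ ?_⟩
  -- Only the target chart is prescribed; the source chart may be centred at `c t`.
  set x₀ := c t with hx₀
  set φ := extChartAt I x₀
  set ψ := chartExpression I f x₀ x₁
  set u : ℝ → E := fun r ↦ φ (c r) with hu
  have hct : c t ∈ φ.source := mem_extChartAt_source (I := I) x₀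
  have hut : u t ∈ φ.target := φ.map_source hct
  have hsymm : φ.symm (u t) = c t := φ.left_inv hct
  have hfu : f (φ.symm (u t)) ∈ (extChartAt I x₁).source := by rw [hsymm]; exact hfct
  have hcont : ContinuousAt c t := (hc.1.contMDiffAt (hs.mem_nhds ht)).continuousAt
  have hcurve : (fun r ↦ extChartAt I x₁ (f (c r))) =ᶠ[𝓝 t] fun r ↦ ψ (u r) := by
    filter_upwards [hcont.eventually ((isOpen_extChartAt_source (I := I) x₀).mem_nhds hct)] with r hr
    simp only [ψ, chartExpression, hu]
    rw [φ.left_inv hr]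
  have hnhds : ∀ᶠ z in 𝓝 (u t), z ∈ φ.target ∧ f (φ.symm z) ∈ (extChartAt I x₁).source := by
    have h1 : ∀ᶠ z in 𝓝 (u t), z ∈ φ.target := (isOpen_extChartAt_target x₀).mem_nhds hut
    refine h1.and (ContinuousAt.eventually_mem ?_
      ((isOpen_extChartAt_source (I := I) x₁).mem_nhds hfu))
    exact hf.continuous.continuousAt.comp
      (((continuousOn_extChartAt_symm x₀).continuousAt h1))
  have hform : ∀ᶠ z in 𝓝 (u t), ∀ a b, chartForm I x₀ z a b =
      chartForm I x₁ (ψ z) (fderiv ℝ ψ z a) (fderiv ℝ ψ z b) :=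
    hnhds.mono fun z hz ↦ chartForm_chartExpression I hf hiso hz.1 hz.2
  have hψt : ψ (u t) = extChartAt I x₁ (f (c t)) := hcurve.self_of_nhds.symm
  have hψmem : ψ (u t) ∈ (extChartAt I x₁).target := by
    rw [hψt]; exact (extChartAt I x₁).map_source hfct
  -- The transported equation is tested only against vectors in the image of `Dψ`. Since `Dψ` pulls
  -- a form back to a definite one it is injective, hence surjective by dimension, and every `w` is
  -- reached.
  have hsurj : Function.Surjective (fderiv ℝ ψ (u t)) := by
    refine (LinearMap.injective_iff_surjective (f := (fderiv ℝ ψ (u t)).toLinearMap)).1 ?_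
    rw [← LinearMap.ker_eq_bot, LinearMap.ker_eq_bot']
    intro a ha
    by_contra h
    refine chartForm_self_ne_zero I hut h ?_
    have ha' : fderiv ℝ ψ (u t) a = 0 := ha
    rw [hform.self_of_nhds, ha', map_zero]
  obtain ⟨w', rfl⟩ := hsurj w
  have htwo : (2 : ℕ∞ω) ≤ ∞ := ENat.LEInfty.out
  have := geodesic_equation_comp (g₀ := chartForm I x₀) (g₁ := chartForm I x₁) (ψ := ψ) (u := u)
    (contDiffAt_curve_in_chart I hs hc.1 ht hct)
    ((contDiffAt_chartExpression I hf hut hfu).of_le htwo)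
    ((contDiffAt_chartForm I hut).differentiableAt (by simp))
    ((contDiffAt_chartForm I hψmem).differentiableAt (by simp))
    (chartForm_comm I x₁ _) hform (hc.chartForm_equation I ht hct w')
  rw [← chartForm_eq_chartMetric, christoffelFirst_eq_christoffelForm I (hψt ▸ hψmem),
    hcurve.deriv_eq, hcurve.deriv.deriv_eq, ← hψt]
  exact this

/-- Geodesics with the same position and velocity at a time agree near that time. -/
theorem IsGeodesicOn.eventuallyEq {c₁ c₂ : ℝ → Q} {s : Set ℝ} (hs : IsOpen s)
    (h₁ : IsGeodesicOn I c₁ s) (h₂ : IsGeodesicOn I c₂ s) {t : ℝ} (ht : t ∈ s) {x₀ : Q}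
    (hct : c₁ t ∈ (extChartAt I x₀).source) (heq : c₁ t = c₂ t)
    (hderiv : deriv (fun r ↦ extChartAt I x₀ (c₁ r)) t = deriv (fun r ↦ extChartAt I x₀ (c₂ r)) t) :
    c₁ =ᶠ[𝓝 t] c₂ := by
  have hct' : c₂ t ∈ (extChartAt I x₀).source := heq ▸ hct
  have hsrc : ∀ c : ℝ → Q, IsGeodesicOn I c s → c t ∈ (extChartAt I x₀).source →
      ∀ᶠ r in 𝓝 t, r ∈ s ∧ c r ∈ (extChartAt I x₀).source := fun c hc h ↦
    (hs.eventually_mem ht).and ((hc.1.contMDiffAt (hs.mem_nhds ht)).continuousAt.eventually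
      ((isOpen_extChartAt_source (I := I) x₀).mem_nhds h))
  have hpos : ∀ᶠ y in 𝓝 (extChartAt I x₀ (c₁ t)), ∀ a, a ≠ 0 → chartForm I x₀ y a a ≠ 0 := by
    filter_upwards [(isOpen_extChartAt_target (I := I) x₀).mem_nhds
      ((extChartAt I x₀).map_source hct)] with y hy a ha
    exact chartForm_self_ne_zero I hy ha
  have htwo : (2 : ℕ∞ω) ≤ ∞ := ENat.LEInfty.out
  have := geodesic_equation_unique (g := chartForm I x₀)
    (contDiffAt_curve_in_chart I hs h₁.1 ht hct) (contDiffAt_curve_in_chart I hs h₂.1 ht hct')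
    ((contDiffAt_chartForm I ((extChartAt I x₀).map_source hct)).of_le htwo) hpos
    ((hsrc c₁ h₁ hct).mono fun r hr w ↦ h₁.chartForm_equation I hr.1 hr.2 w)
    ((hsrc c₂ h₂ hct').mono fun r hr w ↦ h₂.chartForm_equation I hr.1 hr.2 w)
    (by rw [heq]) hderiv
  filter_upwards [this, hsrc c₁ h₁ hct, hsrc c₂ h₂ hct'] with r hr hr₁ hr₂
  exact (extChartAt I x₀).injOn hr₁.2 hr₂.2 hr

/-- Uniqueness of geodesics on an open interval. -/
theorem IsGeodesicOn.eqOn [T2Space Q] {c₁ c₂ : ℝ → Q} {s : Set ℝ} (hs : IsOpen s)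
    (hconn : IsPreconnected s) (h₁ : IsGeodesicOn I c₁ s) (h₂ : IsGeodesicOn I c₂ s)
    {t₀ : ℝ} (ht₀ : t₀ ∈ s) (h₀ : c₁ =ᶠ[𝓝 t₀] c₂) : EqOn c₁ c₂ s := by
  have hsub : s ⊆ {t | c₁ =ᶠ[𝓝 t] c₂} := by
    -- The times near which the curves agree form an open set. At a limit time in `s`, positions
    -- agree because `Q` is Hausdorff and velocities by continuity, so local uniqueness applies
    -- there too.
    refine hconn.subset_of_closure_inter_subset ?_ ⟨t₀, ht₀, h₀⟩ ?_
    · exact isOpen_setOfPred_eventually_nhds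
    · rintro t ⟨hcl, ht⟩
      have hcont : ∀ c : ℝ → Q, IsGeodesicOn I c s → ContinuousAt c t := fun c hc ↦
        (hc.1.contMDiffAt (hs.mem_nhds ht)).continuousAt
      rw [mem_closure_iff_frequently] at hcl
      have heq : c₁ t = c₂ t := tendsto_nhds_unique_of_frequently_eq (hcont c₁ h₁) (hcont c₂ h₂)
        (hcl.mono fun r hr ↦ hr.self_of_nhds)
      have hct : c₁ t ∈ (extChartAt I (c₁ t)).source := mem_extChartAt_source (I := I) _
      refine h₁.eventuallyEq I hs h₂ ht hct heq ?_
      refine tendsto_nhds_unique_of_frequently_eq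
        (contDiffAt_deriv (contDiffAt_curve_in_chart I hs h₁.1 ht hct)).continuousAt
        (contDiffAt_deriv (contDiffAt_curve_in_chart I hs h₂.1 ht (heq ▸ hct))).continuousAt
        (hcl.mono fun r hr ↦ Filter.EventuallyEq.deriv_eq ?_)
      exact hr.fun_comp (extChartAt I (c₁ t))
  exact fun t ht ↦ (hsub ht).self_of_nhds

end Geodesics

end RelEq

namespace RelEq

/-! ### The exponential map and its equivariance -/

section Exponential

variable {E : Type*} [NormedAddCommGroup E] [NormedSpace ℝ E] [FiniteDimensional ℝ E]
  {HQ : Type*} [TopologicalSpace HQ] (I : ModelWithCorners ℝ E HQ) [I.Boundaryless]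
  {Q : Type*} [TopologicalSpace Q] [T2Space Q] [ChartedSpace HQ Q] [IsManifold I ∞ Q]
  [RiemannianBundle (fun q : Q ↦ TangentSpace I q)]
  [IsContMDiffRiemannianBundle I ∞ E (fun q : Q ↦ TangentSpace I q)]

omit [FiniteDimensional ℝ E] [I.Boundaryless] [T2Space Q] [IsManifold I ∞ Q]
  [IsContMDiffRiemannianBundle I ∞ E (fun q : Q ↦ TangentSpace I q)] in
theorem IsGeodesicOn.mono {c : ℝ → Q} {s s' : Set ℝ} (hc : IsGeodesicOn I c s) (h : s' ⊆ s) :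
    IsGeodesicOn I c s' :=
  ⟨hc.1.mono h, fun x₀ t ht ↦ hc.2 x₀ t (h ht)⟩

omit [FiniteDimensional ℝ E] [I.Boundaryless] [T2Space Q]
  [RiemannianBundle (fun q : Q ↦ TangentSpace I q)]
  [IsContMDiffRiemannianBundle I ∞ E (fun q : Q ↦ TangentSpace I q)] in
/-- The derivative of a curve in a chart is the image of its velocity. -/
theorem deriv_curve_in_chart {c : ℝ → Q} {t : ℝ} (hc : MDifferentiableAt 𝓘(ℝ, ℝ) I c t) {x₀ : Q}
    (hct : c t ∈ (extChartAt I x₀).source) :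
    deriv (fun r ↦ extChartAt I x₀ (c r)) t =
      chartDeriv I x₀ (c t) (mfderiv 𝓘(ℝ, ℝ) I c t (1 : ℝ) : TangentSpace I (c t)) := by
  have h1 : MDifferentiableAt I 𝓘(ℝ, E) (extChartAt I x₀) (c t) :=
    mdifferentiableAt_extChartAt (by rwa [← extChartAt_source I])
  have h : HasMFDerivAt 𝓘(ℝ, ℝ) 𝓘(ℝ, E) (fun r ↦ extChartAt I x₀ (c r)) t _ :=
    h1.hasMFDerivAt.comp t hc.hasMFDerivAt
  rw [← fderiv_apply_one_eq_deriv, ← mfderiv_eq_fderiv]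
  exact congrArg (fun L : ℝ →L[ℝ] E ↦ L 1) h.mfderiv

/-- The geodesic with given initial velocity is unique. -/
theorem IsGeodesicFrom.eq_at_one {q : Q} {v : TangentSpace I q} {c₁ c₂ : ℝ → Q}
    (h₁ : IsGeodesicFrom I q v c₁) (h₂ : IsGeodesicFrom I q v c₂) : c₁ 1 = c₂ 1 := by
  obtain ⟨⟨δ₁, hδ₁, hg₁⟩, hv₁⟩ := h₁
  obtain ⟨⟨δ₂, hδ₂, hg₂⟩, hv₂⟩ := h₂
  set s := Ioo (-(min δ₁ δ₂)) (1 + min δ₁ δ₂)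
  have hδ : 0 < min δ₁ δ₂ := lt_min hδ₁ hδ₂
  replace hg₁ : IsGeodesicOn I c₁ s := hg₁.mono I (Ioo_subset_Ioo
    (neg_le_neg (min_le_left _ _)) (add_le_add_right (min_le_left _ _) _))
  replace hg₂ : IsGeodesicOn I c₂ s := hg₂.mono I (Ioo_subset_Ioo
    (neg_le_neg (min_le_right _ _)) (add_le_add_right (min_le_right _ _) _))
  have h0 : (0 : ℝ) ∈ s := ⟨by linarith, by linarith⟩
  have h1 : (1 : ℝ) ∈ s := ⟨by linarith, by linarith⟩
  -- Equality in the tangent bundle compares base points and velocities at once, although they a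
  -- priori lie in different tangent spaces.
  have hv := hv₁.trans hv₂.symm
  have heq : c₁ 0 = c₂ 0 := congrArg TotalSpace.proj hv
  have hsrc : c₁ 0 ∈ (extChartAt I (c₁ 0)).source := mem_extChartAt_source (I := I) _
  have hd : ∀ c : ℝ → Q, IsGeodesicOn I c s → MDifferentiableAt 𝓘(ℝ, ℝ) I c 0 := fun c hc ↦
    (hc.1.contMDiffAt (isOpen_Ioo.mem_nhds h0)).mdifferentiableAt (by simp)
  have h0' : c₁ =ᶠ[𝓝 0] c₂ := by
    refine hg₁.eventuallyEq I isOpen_Ioo hg₂ h0 hsrc heq ?_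
    rw [deriv_curve_in_chart I (hd c₁ hg₁) hsrc, deriv_curve_in_chart I (hd c₂ hg₂) (heq ▸ hsrc)]
    exact congrArg (fun p : TangentBundle I Q ↦ chartDeriv I (c₁ 0) p.1 p.2) hv
  exact hg₁.eqOn I isOpen_Ioo isPreconnected_Ioo hg₂ h0 h0' h1

/-- Uniqueness makes the geodesic chosen in the definition of `Exp` irrelevant. -/
theorem Exp_eq {q : Q} {v : TangentSpace I q} {c : ℝ → Q} (hc : IsGeodesicFrom I q v c) :
    Exp I q v = c 1 := by
  have h : ∃ c : ℝ → Q, IsGeodesicFrom I q v c := ⟨c, hc⟩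
  rw [Exp, dif_pos h]
  exact h.choose_spec.eq_at_one I hc

omit [T2Space Q] in
theorem isGeodesicFrom_const (q : Q) : IsGeodesicFrom I q 0 (fun _ ↦ q) := by
  refine ⟨⟨1, one_pos, contMDiffOn_const, fun x₀ t _ hq w ↦ ?_⟩, ?_⟩
  · rw [← chartForm_eq_chartMetric,
      christoffelFirst_eq_christoffelForm I ((extChartAt I x₀).map_source hq)]
    simp only [deriv_const', deriv_const, christoffelForm_zero, map_zero, zero_apply, add_zero]
  · rw [mfderiv_const]
    rfl

theorem Exp_zero (q : Q) : Exp I q 0 = q :=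
  Exp_eq I (isGeodesicFrom_const I q)

variable {G : Type*} [Group G] [MulAction G Q]

omit [T2Space Q] in
/-- The isotropy group maps geodesics from `q` to geodesics from `q`. -/
theorem IsGeodesicFrom.smul (hact : ∀ g : G, ContMDiff I I ∞ (fun x : Q ↦ g • x))
    (hisom : ActsByIsometries I Q G) {q : Q} (h : stabilizer G q)
    {v : TangentSpace I q} {c : ℝ → Q} (hc : IsGeodesicFrom I q v c) :
    IsGeodesicFrom I q (tangentAction I h v) (fun t ↦ (h : G) • c t) := by
  obtain ⟨⟨δ, hδ, hg⟩, hv⟩ := hc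
  have hf := hact (h : G)
  refine ⟨⟨δ, hδ, hg.isometry_comp I hf (fun x a b ↦ hisom h x a b) isOpen_Ioo⟩, ?_⟩
  have hd : MDifferentiableAt 𝓘(ℝ, ℝ) I c 0 :=
    (hg.1.contMDiffAt (isOpen_Ioo.mem_nhds ⟨by linarith, by linarith⟩)).mdifferentiableAt (by simp)
  have hcomp : HasMFDerivAt 𝓘(ℝ, ℝ) I (fun t ↦ (h : G) • c t) 0 _ :=
    ((hf.mdifferentiable (by simp)) (c 0)).hasMFDerivAt.comp 0 hd.hasMFDerivAt
  -- The new velocity lies over `h • q`; all tangent spaces share the model `E`, so only the base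
  -- point has to be replaced by `q`.
  have hmk : ∀ {x y : Q} (_ : x = y) (w : E),
      (TotalSpace.mk x w : TangentBundle I Q) = TotalSpace.mk y w := by
    rintro x _ rfl w; rfl
  have htan := congrArg (fun p : TangentBundle I Q ↦
    (⟨(h : G) • p.1, mfderiv I I (fun x : Q ↦ (h : G) • x) p.1 p.2⟩ : TangentBundle I Q)) hv
  rw [hcomp.mfderiv]
  exact htan.trans (hmk (mem_stabilizer_iff.1 h.2) _)

/-- The exponential map is equivariant under the isotropy group. -/
theorem Exp_tangentAction (hact : ∀ g : G, ContMDiff I I ∞ (fun x : Q ↦ g • x))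
    (hisom : ActsByIsometries I Q G) {q : Q} (h : stabilizer G q)
    {v : TangentSpace I q} (hv : v ∈ expDomain I q) :
    Exp I q (tangentAction I h v) = h • Exp I q v := by
  obtain ⟨c, hc⟩ := hv
  rw [Exp_eq I hc, Exp_eq I (hc.smul I hact hisom h)]
  rfl

omit [T2Space Q] [IsContMDiffRiemannianBundle I ∞ E (fun q : Q ↦ TangentSpace I q)] in
omit [FiniteDimensional ℝ E] [I.Boundaryless] [IsManifold I ∞ Q] in
/-- The derivative of the exponential map is invertible on an exponential neighbourhood. -/
theorem IsExpNeighborhood.isInvertible_mfderiv {q : Q} {V : Set (TangentSpace I q)}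
    (hV : IsExpNeighborhood I G q V) {v : TangentSpace I q} (hv : v ∈ V) :
    (mfderiv 𝓘(ℝ, TangentSpace I q) I (Exp I q) v).IsInvertible := by
  obtain ⟨Log, hLog, hsm⟩ := hV.smooth_inverse
  have hE : MDifferentiableAt 𝓘(ℝ, TangentSpace I q) I (Exp I q) v :=
    (hV.smooth.contMDiffAt (hV.isOpen.mem_nhds hv)).mdifferentiableAt (by simp)
  have himg : Exp I q '' V ∈ 𝓝 (Exp I q v) := hV.isOpen_image.mem_nhds (mem_image_of_mem _ hv)
  have hL : MDifferentiableAt I 𝓘(ℝ, TangentSpace I q) Log (Exp I q v) :=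
    (hsm.contMDiffAt himg).mdifferentiableAt (by simp)
  have hLv : Log (Exp I q v) = v := hLog hv
  have h1 : HasMFDerivAt 𝓘(ℝ, TangentSpace I q) 𝓘(ℝ, TangentSpace I q)
      (Log ∘ Exp I q) v (ContinuousLinearMap.id ℝ _) :=
    (hasMFDerivAt_id v).congr_of_eventuallyEq
      (Filter.eventuallyEq_of_mem (hV.isOpen.mem_nhds hv) hLog)
  have hE' : HasMFDerivAt 𝓘(ℝ, TangentSpace I q) I (Exp I q) (Log (Exp I q v))
      (mfderiv 𝓘(ℝ, TangentSpace I q) I (Exp I q) v) := by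
    rw [hLv]
    exact hE.hasMFDerivAt
  -- `Exp ∘ Log` is the identity only on the image of `V`; openness of that image makes this enough
  -- for the derivative.
  have h2 : HasMFDerivAt I I (Exp I q ∘ Log) (Exp I q v) (ContinuousLinearMap.id ℝ _) := by
    refine (hasMFDerivAt_id (Exp I q v)).congr_of_eventuallyEq
      (Filter.eventuallyEq_of_mem himg ?_)
    rintro _ ⟨w, hw, rfl⟩
    simp [hLog hw]
  exact ContinuousLinearMap.IsInvertible.of_inverse
    (g := mfderiv I 𝓘(ℝ, TangentSpace I q) Log (Exp I q v))
    (hasMFDerivAt_unique (hE'.comp _ hL.hasMFDerivAt) h2)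
    (hasMFDerivAt_unique (hL.hasMFDerivAt.comp v hE.hasMFDerivAt) h1)

/-- By equivariance, `h` fixes the image of `v` exactly when `h · v` and `v` have the same image;
both lie in `V`, where `Exp` is injective. -/
theorem tangentIsotropy_eq (hact : ∀ g : G, ContMDiff I I ∞ (fun x : Q ↦ g • x))
    (hisom : ActsByIsometries I Q G) {q : Q} {V : Set (TangentSpace I q)}
    (hV : IsExpNeighborhood I G q V) {v : TangentSpace I q} (hv : v ∈ V) :
    (stabilizer (stabilizer G q) (Exp I q v) : Set (stabilizer G q)) = tangentIsotropy I G v := by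
  ext h
  rw [SetLike.mem_coe, mem_stabilizer_iff, ← Exp_tangentAction I hact hisom h (hV.subset_domain hv)]
  exact hV.injOn.eq_iff (hV.invariant h v hv) hv

end Exponential

end RelEq

namespace RelEq

/-! ### Transport of relative equilibria -/

section RelativeEquilibria

variable {E : Type*} [NormedAddCommGroup E] [NormedSpace ℝ E] [FiniteDimensional ℝ E]
  {HQ : Type*} [TopologicalSpace HQ] (I : ModelWithCorners ℝ E HQ) [I.Boundaryless]
  {Q : Type*} [TopologicalSpace Q] [T2Space Q] [ChartedSpace HQ Q] [IsManifold I ∞ Q]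
  [RiemannianBundle (fun q : Q ↦ TangentSpace I q)]
  [IsContMDiffRiemannianBundle I ∞ E (fun q : Q ↦ TangentSpace I q)]
  {F : Type*} [NormedAddCommGroup F] [NormedSpace ℝ F]
  {HG : Type*} [TopologicalSpace HG] (J : ModelWithCorners ℝ F HG)
  {G : Type*} [TopologicalSpace G] [ChartedSpace HG G] [Group G] [MulAction G Q]

/-- The exponential map sends relative equilibria of the pullback of a vector field, for the linear
action of the isotropy group, to relative equilibria of the vector field. -/
theorem IsTangentRelativeEquilibrium.isRelativeEquilibrium_Exp
    (hact : ∀ g : G, ContMDiff I I ∞ (fun x : Q ↦ g • x)) (hisom : ActsByIsometries I Q G)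
    {X : Π q : Q, TangentSpace I q} {q : Q} {V : Set (TangentSpace I q)}
    (hV : IsExpNeighborhood I G q V) {v : TangentSpace I q} (hv : v ∈ V)
    (h : IsTangentRelativeEquilibrium I J G q (expPullback I q X) v) :
    IsRelativeEquilibrium I J G X (Exp I q v) := by
  obtain ⟨ξ, c, hc, hd⟩ := h
  refine ⟨ξ, fun t ↦ (c t : G), hc, ?_⟩
  -- The orbit curve in `Q` is the image of the linear orbit curve, so its velocity comes from the
  -- chain rule.
  have hcurve : (fun t ↦ (c t : G) • Exp I q v) = fun t ↦ Exp I q (tangentAction I (c t) v) := by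
    funext t
    rw [Exp_tangentAction I hact hisom (c t) (hV.subset_domain hv)]
    rfl
  have hc0 : (c 0 : G) = 1 := congrArg TotalSpace.proj hc.2.2
  -- Injectivity of `Exp` on `V` replaces a computation of the derivative of the identity.
  have hv0 : tangentAction I (c 0) v = v := by
    refine hV.injOn (hV.invariant _ v hv) hv ?_
    rw [Exp_tangentAction I hact hisom (c 0) (hV.subset_domain hv)]
    change (c 0 : G) • Exp I q v = _
    rw [hc0, one_smul]
  have hE : MDifferentiableAt 𝓘(ℝ, TangentSpace I q) I (Exp I q) v :=
    (hV.smooth.contMDiffAt (hV.isOpen.mem_nhds hv)).mdifferentiableAt (by simp)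
  have hE' : HasMFDerivAt 𝓘(ℝ, TangentSpace I q) I (Exp I q) (tangentAction I (c 0) v)
      (mfderiv 𝓘(ℝ, TangentSpace I q) I (Exp I q) v) := by
    rw [hv0]
    exact hE.hasMFDerivAt
  have hd' : HasMFDerivAt 𝓘(ℝ, ℝ) 𝓘(ℝ, TangentSpace I q) (fun t ↦ tangentAction I (c t) v) 0
      ((1 : ℝ →L[ℝ] ℝ).smulRight (expPullback I q X v)) :=
    hasMFDerivAt_iff_hasFDerivAt.2 hd.hasFDerivAt
  -- Invertibility of the derivative makes the pullback a genuine inverse image rather than the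
  -- default value of `inverse`.
  have hXv : mfderiv 𝓘(ℝ, TangentSpace I q) I (Exp I q) v (expPullback I q X v) = X (Exp I q v) :=
    (hV.isInvertible_mfderiv I hv).self_apply_inverse _
  have hX0 : (X ((c 0 : G) • Exp I q v) : E) = X (Exp I q v) :=
    congrArg (fun x ↦ (X x : E)) (by rw [hc0, one_smul])
  have hL : ((mfderiv 𝓘(ℝ, TangentSpace I q) I (Exp I q) v).comp
      ((1 : ℝ →L[ℝ] ℝ).smulRight (expPullback I q X v)) : ℝ →L[ℝ] E) =
      (1 : ℝ →L[ℝ] ℝ).smulRight (X ((c 0 : G) • Exp I q v) : E) := by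
    refine ContinuousLinearMap.ext_ring ?_
    rw [hX0]
    change mfderiv 𝓘(ℝ, TangentSpace I q) I (Exp I q) v ((1 : ℝ) • expPullback I q X v) =
      (1 : ℝ) • X (Exp I q v)
    rw [one_smul, one_smul, hXv]
  rw [hcurve]
  exact (hE'.comp 0 hd').congr_mfderiv hL

end RelativeEquilibria

end RelEq

theorem mainTheorem6
    {E : Type*} [NormedAddCommGroup E] [NormedSpace ℝ E] [FiniteDimensional ℝ E]
    {HQ : Type*} [TopologicalSpace HQ] (I : ModelWithCorners ℝ E HQ) [I.Boundaryless]
    {Q : Type*} [TopologicalSpace Q] [T2Space Q] [ChartedSpace HQ Q] [IsManifold I ∞ Q]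
    [RiemannianBundle (fun q : Q ↦ TangentSpace I q)]
    [IsContMDiffRiemannianBundle I ∞ E (fun q : Q ↦ TangentSpace I q)]
    {F : Type*} [NormedAddCommGroup F] [NormedSpace ℝ F] [FiniteDimensional ℝ F]
    {HG : Type*} [TopologicalSpace HG] (J : ModelWithCorners ℝ F HG) [J.Boundaryless]
    {G : Type*} [TopologicalSpace G] [T2Space G] [ChartedSpace HG G] [Group G] [LieGroup J ∞ G]
    [MulAction G Q] [ContMDiffSMul J I ∞ G Q] [ProperSMul G Q]
    (hisom : RelEq.ActsByIsometries I Q G)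
    (X : ℝ → Π q : Q, TangentSpace I q)
    (hsmooth : ∀ l, RelEq.IsSmoothVectorField I (X l))
    (hequiv : ∀ l, RelEq.IsEquivariant I G (X l))
    (l₀ : ℝ) (qe : Q) (hqe : RelEq.IsRelativeEquilibrium I J G (X l₀) qe)
    (V : Set (TangentSpace I qe)) (hV : RelEq.IsExpNeighborhood I G qe V)
    (H : Subgroup (stabilizer G qe))
    (ε : ℝ) (hε : 0 < ε)
    (γ : ℝ → TangentSpace I qe) (hγ : ContinuousOn γ (Icc l₀ (l₀ + ε)))
    (hγV : MapsTo γ (Icc l₀ (l₀ + ε)) V) (hγ₀ : γ l₀ = 0)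
    (hγeq : ∀ l ∈ Ioc l₀ (l₀ + ε),
      RelEq.IsTangentRelativeEquilibrium I J G qe (RelEq.expPullback I qe (X l)) (γ l))
    (hγiso : ∀ l ∈ Ioc l₀ (l₀ + ε),
      RelEq.IsConjugateTo (RelEq.tangentIsotropy I G (γ l)) H) :
    ContinuousOn (fun l ↦ RelEq.Exp I qe (γ l)) (Icc l₀ (l₀ + ε)) ∧
    MapsTo (fun l ↦ RelEq.Exp I qe (γ l)) (Icc l₀ (l₀ + ε)) (RelEq.Exp I qe '' V) ∧
    (∀ l ∈ Icc l₀ (l₀ + ε),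
      RelEq.IsRelativeEquilibrium I J G (X l) (RelEq.Exp I qe (γ l))) ∧
    (∀ l ∈ Ioc l₀ (l₀ + ε),
      RelEq.IsConjugateTo
        (stabilizer (stabilizer G qe) (RelEq.Exp I qe (γ l)) : Set (stabilizer G qe)) H) ∧
    RelEq.IsConjugateTo
      (stabilizer (stabilizer G qe) (RelEq.Exp I qe (γ l₀)) : Set (stabilizer G qe)) ⊤ ∧
    RelEq.IsConjugateTo (stabilizer G (RelEq.Exp I qe (γ l₀)) : Set G) (stabilizer G qe) := by
  have hact : ∀ g : G, ContMDiff I I ∞ (fun x : Q ↦ g • x) := fun g ↦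
    (contMDiff_smul (I := J) (I' := I) (n := ∞) (G := G) (M := Q)).comp
      (contMDiff_const.prodMk contMDiff_id)
  have h₀ : RelEq.Exp I qe (γ l₀) = qe := by rw [hγ₀, RelEq.Exp_zero]
  -- At `l₀` the image point is `qe`, so the groups in the last two claims are equal and conjugation
  -- by `1` suffices.
  refine ⟨hV.smooth.continuousOn.comp hγ hγV, fun l hl ↦ mem_image_of_mem _ (hγV hl),
    fun l hl ↦ ?_, fun l hl ↦ ?_, ⟨1, ?_⟩, ⟨1, ?_⟩⟩
  -- At the left endpoint nothing is assumed about the pullback; the claim is the hypothesis on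
  -- `qe`.
  · rcases hl.1.eq_or_lt with rfl | hlt
    · rwa [h₀]
    · exact (hγeq l ⟨hlt, hl.2⟩).isRelativeEquilibrium_Exp I J hact hisom hV (hγV hl)
  · rw [RelEq.tangentIsotropy_eq I hact hisom hV (hγV (Ioc_subset_Icc_self hl))]
    exact hγiso l hl
  · ext h
    simp [h₀, Subgroup.smul_def, mem_stabilizer_iff.1 h.2]
  · ext g
    simp [h₀]
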